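/- All rings and algebras are commutative with identity. Let $R$ be a ring, $n\ge 0$, and let $A$ be an $R$-algebra of rank $n$, i.e. finitely generated projective and locally free of constant rank $n$ as an $R$-module. For an $R$-algebra $R'$ and $a\in A\otimes_R R'$ let $P_a(X)\in R'[X]$ be the characteristic polynomial of multiplication by $a$ on the rank $n$ module $A\otimes_R R'$ (the determinant of $X-a$ acting on $(A\otimes_R R')\otimes_{R'}R'[X]$). For a finite set $S$, an $S$-closure of $A$ is an $R$-algebra $A^{(S)}$ with $R$-algebra maps $\alpha_s\colon A\to A^{(S)}$, $s\in S$, such that (i) for every $R$-algebra $R'$ and every $a\in A\otimes_R R'$ the polynomial $\prod_{s\in S}\bigl(X-(\alpha_s\otimes\mathrm{Id})(a)\bigr)$ divides $P_a(X)$ in $(A^{(S)}\otimes_R R')[X]$; and (ii) for every $R$-algebra $B$ with $R$-algebra maps $\beta_s\colon A\to B$, $s\in S$, satisfying the condition in (i) (with $B$, $\beta_s$ in place of $A^{(S)}$, $\alpha_s$) there is a unique $R$-algebra map $\varphi\colon A^{(S)}\to B$ with $\varphi\circ\alpha_s=\beta_s$ for all $s\in S$. For $S=\{1,\dots,n\}$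 write $A^{(n)}$ (the $n$-closure). The Bhargava–Satriano Galois closure is $$G(A/R)=A^{\otimes n}/I,$$ where $I$ is the ideal generated, for all $a\in A$, by the coefficients of $P_a(X)-\prod_{i=1}^n\bigl(X-\varepsilon_i(a)\bigr)$, with $\varepsilon_i\colon A\to A^{\otimes n}$ the $i$-th coprojection; let $f_i\colon A\to G(A/R)$ be the map induced by $\varepsilon_i$. Proposition. The $n$-closure $A^{(n)}$ is isomorphic to $G(A/R)$. More precisely, $G(A/R)$ with the maps $f_1,\dots,f_n$ is an $n$-closure of $A$, and for every $n$-closure $(A^{(n)},(\alpha_i))$ of $A$ there is a unique $R$-algebra isomorphism $e\colon A^{(n)}\to G(A/R)$ with $e\circ\alpha_i=f_i$ for all $i$. -/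

import Mathlib

open Polynomial TensorProduct

universe u v

namespace SClosure

noncomputable section

section Trace

variable {R : Type*} [CommRing R] {M : Type*} [AddCommGroup M] [Module R M]

/-- Exterior powers of finitely generated projective modules are projective. -/
theorem exteriorPower_projective [Module.Finite R M] [Module.Projective R M] (i : ℕ) :
    Module.Projective R (⋀[R]^i M) := by
  obtain ⟨k, f, g, -, -, hfg⟩ := Module.Finite.exists_comp_eq_id_of_projective R M
  refine Module.Projective.of_split (exteriorPower.map i g) (exteriorPower.map i f) ?_
  rw [← exteriorPower.map_comp, hfg, exteriorPower.map_id]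

/-- The trace of an endomorphism of a finitely generated projective module: the inverse of the
isomorphism `Dual R M ⊗ M ≃ End R M` followed by evaluation `φ ⊗ m ↦ φ m`.
(`LinearMap.trace` is only meaningful for free modules.) -/
def trace [Module.Finite R M] [Module.Projective R M] (f : Module.End R M) : R :=
  contractLeft R M ((dualTensorHomEquiv R M M).symm f)

/-- The `i`-th trace `s_i(f)`: the trace of the endomorphism induced by `f` on `⋀^i M`. -/
def ithTrace [Module.Finite R M] [Module.Projective R M] (i : ℕ) (f : Module.End R M) : R :=
  haveI := exteriorPower_projective (R := R) (M := M) i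
  trace (exteriorPower.map i f)

/-- The characteristic polynomial of an endomorphism `f` of a module `M` of rank `n`: the
determinant, that is, the `n`-th trace, of the endomorphism `X - f` of `R[X] ⊗ M`. -/
def charpoly [Module.Finite R M] [Module.Projective R M] (n : ℕ) (f : Module.End R M) : R[X] :=
  ithTrace n ((X : R[X]) • (LinearMap.id : Module.End R[X] (R[X] ⊗[R] M)) - f.baseChange R[X])

end Trace

/-- The characteristic polynomial `P_a` of an element `a` of an algebra of rank `n`. -/
def elemCharpoly (R : Type*) [CommRing R] {A : Type*} [CommRing A] [Algebra R A]
    [Module.Finite R A] [Module.Projective R A] (n : ℕ) (a : A) : R[X] :=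
  charpoly n (Algebra.lmul R A a)

section Closure

variable (R : Type u) [CommRing R] (A : Type v) [CommRing A] [Algebra R A]
  [Module.Finite R A] [Module.Projective R A] (n : ℕ)

/-- For maps `β_s : A → B`, `s ∈ S`: for every `R → R'` and every `a` in the base change of `A`,
`∏ s, (X - β_s(a))` divides the characteristic polynomial of `a` over the base change of `B`. -/
def DividesCharpoly {S : Type*} [Fintype S] {B : Type*} [CommRing B] [Algebra R B]
    (β : S → A →ₐ[R] B) : Prop :=
  ∀ (R' : Type (max u v)) [CommRing R'] [Algebra R R'] (a : R' ⊗[R] A),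
    ∏ s, (X - C (Algebra.TensorProduct.map (AlgHom.id R' R') (β s) a)) ∣
      (elemCharpoly R' n a).map (algebraMap R' (R' ⊗[R] B))

/-- `(C, α)` is an `S`-closure of the algebra `A` of rank `n`. -/
structure IsSClosure {S : Type*} [Fintype S] {C : Type (max u v)} [CommRing C] [Algebra R C]
    (α : S → A →ₐ[R] C) : Prop where
  dividesCharpoly : DividesCharpoly R A n α
  existsUnique_lift : ∀ (B : Type (max u v)) [CommRing B] [Algebra R B] (β : S → A →ₐ[R] B),
    DividesCharpoly R A n β → ∃! φ : C →ₐ[R] B, ∀ s, φ.comp (α s) = β s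

/-- The ideal of `A^{⊗n}` generated, for all `a : A`, by the coefficients of the difference of
`P_a` and `∏ i, (X - a^{(i)})`, where `a^{(i)}` is `a` in the `i`-th tensor factor. -/
def galoisIdeal : Ideal (⨂[R] _ : Fin n, A) :=
  Ideal.span {x | ∃ (a : A) (j : ℕ),
    x = ((elemCharpoly R n a).map (algebraMap R (⨂[R] _ : Fin n, A)) -
      ∏ i : Fin n, (X - C (PiTensorProduct.singleAlgHom (R := R) (A := fun _ : Fin n ↦ A) i a))
      ).coeff j}

/-- The Galois closure `G(A/R)` of Bhargava and Satriano. -/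
abbrev GaloisClosure : Type (max u v) :=
  (⨂[R] _ : Fin n, A) ⧸ galoisIdeal R A n

/-- The `i`-th natural map `A → G(A/R)`. -/
def galoisMap (i : Fin n) : A →ₐ[R] GaloisClosure R A n :=
  (Ideal.Quotient.mkₐ R (galoisIdeal R A n)).comp
    (PiTensorProduct.singleAlgHom (R := R) (A := fun _ : Fin n ↦ A) i)

end Closure

end

end SClosure

/-! For maps `A → B`, divisibility of `P_a` by `∏ (X - β_i a)` is equality, since both are monic of
degree `n` when `B` is nonzero. Maps out of `A^{⊗n}` killing the ideal `I` are thus exactly the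
tuples splitting `P_a` for `a : A`. What remains is that this splitting for `a : A` forces it over
every base change (`map_elemCharpoly_eq_prod`).

The norm and `u ↦ ∏ f_i(u)` are both multiplicative, and the hypothesis makes them agree on all `1 +
q ⊗ a`. If `t` is nilpotent, products of such elements exhaust all `1 + t y` (`one_add_smul_mem`).
Taking `t = X` in `Q[X]/(X^{n+1})` and `y = -a`, the norm of `1 - X a` is the reversed `P_a`
(`elemCharpoly_reflect`), which has degree at most `n` and so survives truncation. -/

namespace SClosure

noncomputable section

/-! ### Traces on exterior powers, computed with a finite dual system. -/

section LinearAlgebra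

open Set.powersetCard

variable {R : Type*} [CommRing R] {M : Type*} [AddCommGroup M] [Module R M]
  [Module.Finite R M] [Module.Projective R M]

theorem trace_eq_sum {ι : Type*} [Fintype ι] (m : ι → M) (μ : ι → Module.Dual R M)
    (h : ∀ x, ∑ i, μ i x • m i = x) (f : Module.End R M) :
    trace f = ∑ i, μ i (f (m i)) := by
  have hf : f = dualTensorHomEquiv R M M (∑ i, μ i ⊗ₜ[R] f (m i)) := by
    ext x
    conv_lhs => rw [← h x]
    simp [dualTensorHomEquiv]
  unfold trace
  conv_lhs => rw [hf]
  simp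

omit [Module.Finite R M] [Module.Projective R M] in
-- The system makes `M` a retract of `ι → R`; the basis expansion in the exterior power of the free
-- module is pushed down to `M`.
theorem sum_pairingDual_smul {ι : Type*} [Fintype ι] [LinearOrder ι] (m : ι → M)
    (μ : ι → Module.Dual R M) (h : ∀ x, ∑ i, μ i x • m i = x) (j : ℕ) (x : ⋀[R]^j M) :
    ∑ s : Set.powersetCard ι j, exteriorPower.pairingDual R M j
      (exteriorPower.ιMulti_family R j μ s) x • exteriorPower.ιMulti_family R j m s = x := by
  let p : (ι → R) →ₗ[R] M := (Pi.basisFun R ι).constr R m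
  let i : M →ₗ[R] (ι → R) := LinearMap.pi μ
  have hp (a : ι) : p (Pi.basisFun R ι a) = m a := by simp only [p, Module.Basis.constr_basis]
  have hpi : p ∘ₗ i = LinearMap.id := by
    ext x
    simp only [LinearMap.comp_apply, LinearMap.id_apply]
    rw [← (Pi.basisFun R ι).sum_repr (i x), map_sum]
    simp only [map_smul, hp]
    simpa [i] using h x
  have hx : exteriorPower.map j p (exteriorPower.map j i x) = x := by
    rw [← LinearMap.comp_apply, ← exteriorPower.map_comp, hpi, exteriorPower.map_id,
      LinearMap.id_apply]
  conv_rhs => rw [← hx, ← ((Pi.basisFun R ι).exteriorPower j).sum_repr (exteriorPower.map j i x),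
    map_sum]
  refine Finset.sum_congr rfl fun s _ ↦ ?_
  rw [map_smul, exteriorPower.coe_basis, exteriorPower.map_apply_ιMulti_family,
    exteriorPower.basis_repr_apply]
  have h1 : exteriorPower.pairingDual R M j (exteriorPower.ιMulti_family R j μ s) =
      exteriorPower.ιMultiDual R j (Pi.basisFun R ι) s ∘ₗ exteriorPower.map j i := by
    ext v
    simp [exteriorPower.ιMulti_family, i]
  have h2 : (⇑p ∘ ⇑(Pi.basisFun R ι)) = m := funext hp
  rw [h1, h2]
  rfl

theorem ithTrace_eq_sum {ι : Type*} [Fintype ι] [LinearOrder ι] (m : ι → M)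
    (μ : ι → Module.Dual R M) (h : ∀ x, ∑ i, μ i x • m i = x) (j : ℕ) (f : Module.End R M) :
    ithTrace j f = ∑ s : Set.powersetCard ι j, Matrix.det (Matrix.of fun a b : Fin j ↦
      μ (ofFinEmbEquiv.symm s b) (f (m (ofFinEmbEquiv.symm s a)))) := by
  have := exteriorPower_projective (R := R) (M := M) j
  unfold ithTrace
  rw [trace_eq_sum _ _ (sum_pairingDual_smul m μ h j)]
  refine Finset.sum_congr rfl fun s _ ↦ ?_
  rw [exteriorPower.map_apply_ιMulti_family]
  simp [exteriorPower.ιMulti_family]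

variable (R M) in
theorem exists_dual_system : ∃ (k : ℕ) (m : Fin k → M) (μ : Fin k → Module.Dual R M),
    ∀ x, ∑ i, μ i x • m i = x := by
  obtain ⟨k, f, g, -, -, hfg⟩ := Module.Finite.exists_comp_eq_id_of_projective R M
  refine ⟨k, fun i ↦ f (Pi.single i 1), fun i ↦ LinearMap.proj i ∘ₗ g, fun x ↦ ?_⟩
  have hx : f (g x) = x := LinearMap.congr_fun hfg x
  conv_rhs => rw [← hx, ← (Pi.basisFun R (Fin k)).sum_repr (g x), map_sum]
  simp

/-- A dual system base changes to a dual system, and the determinant formula of `ithTrace_eq_sum`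
commutes with ring maps. -/
theorem ithTrace_isBaseChange {S : Type*} [CommRing S] [Algebra R S] {N : Type*}
    [AddCommGroup N] [Module R N] [Module S N] [IsScalarTower R S N] [Module.Finite S N]
    [Module.Projective S N] (θ : M →ₗ[R] N) (hθ : IsBaseChange S θ) (j : ℕ)
    (f : Module.End R M) (g : Module.End S N) (hfg : ∀ x, g (θ x) = θ (f x)) :
    ithTrace j g = algebraMap R S (ithTrace j f) := by
  obtain ⟨k, m, μ, h⟩ := exists_dual_system R M
  let μ' (i : Fin k) : Module.Dual S N := hθ.lift ((Algebra.linearMap R S) ∘ₗ μ i)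
  have hμ' (i : Fin k) (x : M) : μ' i (θ x) = algebraMap R S (μ i x) := hθ.lift_eq _ _
  have h' : ∀ x, ∑ i, μ' i x • θ (m i) = x := by
    have : (∑ i, (μ' i).smulRight (θ (m i))) = (LinearMap.id : N →ₗ[S] N) := by
      refine hθ.algHom_ext _ _ fun x ↦ ?_
      simp only [LinearMap.sum_apply, LinearMap.smulRight_apply, hμ', LinearMap.id_apply,
        algebraMap_smul, ← map_smul, ← map_sum, h]
    intro x
    simpa using LinearMap.congr_fun this x
  rw [ithTrace_eq_sum _ _ h', ithTrace_eq_sum _ _ h, map_sum]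
  refine Finset.sum_congr rfl fun s _ ↦ ?_
  rw [RingHom.map_det]
  congr 1
  ext a b
  simp [hfg, hμ']

theorem ithTrace_smul (j : ℕ) (r : R) (f : Module.End R M) :
    ithTrace j (r • f) = r ^ j * ithTrace j f := by
  obtain ⟨k, m, μ, h⟩ := exists_dual_system R M
  rw [ithTrace_eq_sum _ _ h, ithTrace_eq_sum _ _ h, Finset.mul_sum]
  refine Finset.sum_congr rfl fun s _ ↦ ?_
  have := Matrix.det_smul (Matrix.of fun a b : Fin j ↦
    μ (ofFinEmbEquiv.symm s b) (f (m (ofFinEmbEquiv.symm s a)))) r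
  rw [Fintype.card_fin] at this
  rw [← this]
  congr 1
  ext a b
  simp

theorem ithTrace_eq_det {n : ℕ} (b : Module.Basis (Fin n) R M) (f : Module.End R M) :
    ithTrace n f = LinearMap.det f := by
  rw [ithTrace_eq_sum b b.coord (fun x ↦ b.sum_repr x)]
  have : Unique (Set.powersetCard (Fin n) n) :=
    { default := ⟨Finset.univ, by simp [Set.powersetCard]⟩
      uniq := fun s ↦ Subtype.ext (Finset.eq_univ_of_card _ (by simp)) }
  rw [Fintype.sum_unique, ← LinearMap.det_toMatrix b, ← Matrix.det_transpose]
  set e := ofFinEmbEquiv.symm (default : Set.powersetCard (Fin n) n)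
  have he (i : Fin n) : e i = i := by
    refine congrFun ((StrictMono.range_inj (f := e) (g := id) e.strictMono strictMono_id).1 ?_) i
    rw [(Finite.surjective_of_injective e.injective).range_eq, Set.range_id]
  congr 1
  ext i j
  simp [he, LinearMap.toMatrix_apply]

end LinearAlgebra

/-! ### Multiplicativity of the top trace in constant rank. -/

section Rank

variable {R : Type*} [CommRing R] {M : Type*} [AddCommGroup M] [Module R M]
  [Module.Finite R M] [Module.Projective R M] {n : ℕ}

/-- Equality in a ring can be checked in the localizations at all primes. -/
theorem eq_of_forall_localization {x y : R}
    (h : ∀ p : PrimeSpectrum R, algebraMap R (Localization.AtPrime p.asIdeal) x =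
      algebraMap R (Localization.AtPrime p.asIdeal) y) : x = y := by
  refine Module.eq_of_localization_maximal (R := R) (M := R)
    (fun P _ ↦ Localization.AtPrime P) (fun P _ ↦ Algebra.linearMap R (Localization.AtPrime P))
    x y fun P hP ↦ ?_
  exact h ⟨P, hP.isPrime⟩

/-- Over a local ring the module is free of rank `n`, so identities for the top trace reduce to
those of the determinant. -/
theorem algebraMap_ithTrace_eq_det (hrank : ∀ p : PrimeSpectrum R, Module.rankAtStalk M p = n)
    (p : PrimeSpectrum R) (f : Module.End R M) :
    algebraMap R (Localization.AtPrime p.asIdeal) (ithTrace n f) =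
      LinearMap.det (f.baseChange (Localization.AtPrime p.asIdeal)) := by
  let S := Localization.AtPrime p.asIdeal
  have : Module.Free S (S ⊗[R] M) := Module.free_of_flat_of_isLocalRing
  have hr : Module.finrank S (S ⊗[R] M) = n := by
    rw [← hrank p, Module.rankAtStalk_eq_finrank_tensorProduct]
  rw [← ithTrace_eq_det (Module.finBasisOfFinrankEq S (S ⊗[R] M) hr)]
  exact (ithTrace_isBaseChange _ (TensorProduct.isBaseChange R M S) n f _ fun x ↦ rfl).symm

theorem ithTrace_one (hrank : ∀ p : PrimeSpectrum R, Module.rankAtStalk M p = n) :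
    ithTrace n (1 : Module.End R M) = 1 := by
  refine eq_of_forall_localization fun p ↦ ?_
  rw [algebraMap_ithTrace_eq_det hrank, map_one]
  have : (1 : Module.End R M).baseChange (Localization.AtPrime p.asIdeal) = 1 :=
    LinearMap.baseChange_id
  rw [this, map_one]

theorem ithTrace_mul (hrank : ∀ p : PrimeSpectrum R, Module.rankAtStalk M p = n)
    (f g : Module.End R M) : ithTrace n (f * g) = ithTrace n f * ithTrace n g := by
  refine eq_of_forall_localization fun p ↦ ?_
  rw [map_mul, algebraMap_ithTrace_eq_det hrank, algebraMap_ithTrace_eq_det hrank,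
    algebraMap_ithTrace_eq_det hrank, ← map_mul]
  congr 1
  exact LinearMap.baseChange_comp _ _

end Rank

/-! ### Norms, their base change, and characteristic polynomials as norms. -/

section Norm

variable (R : Type*) [CommRing R] {E : Type*} [CommRing E] [Algebra R E]
  [Module.Finite R E] [Module.Projective R E] (n : ℕ)

/-- The norm of an element of an algebra of rank `n`. -/
def elemNorm (u : E) : R := ithTrace n (Algebra.lmul R E u)

variable {R n}

theorem elemNorm_one (hrank : ∀ p : PrimeSpectrum R, Module.rankAtStalk E p = n) :
    elemNorm R n (1 : E) = 1 := by
  rw [elemNorm, map_one, ithTrace_one hrank]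

theorem elemNorm_mul (hrank : ∀ p : PrimeSpectrum R, Module.rankAtStalk E p = n) (u v : E) :
    elemNorm R n (u * v) = elemNorm R n u * elemNorm R n v := by
  rw [elemNorm, map_mul, ithTrace_mul hrank]
  rfl

theorem elemNorm_smul (r : R) (u : E) : elemNorm R n (r • u) = r ^ n * elemNorm R n u := by
  rw [elemNorm, map_smul, ithTrace_smul]
  rfl

theorem elemNorm_isBaseChange {S : Type*} [CommRing S] [Algebra R S] {F : Type*} [CommRing F]
    [Algebra R F] [Algebra S F] [IsScalarTower R S F] [Module.Finite S F] [Module.Projective S F]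
    (θ : E →ₐ[R] F) (hθ : IsBaseChange S θ.toLinearMap) (u : E) :
    elemNorm S n (θ u) = algebraMap R S (elemNorm R n u) :=
  ithTrace_isBaseChange θ.toLinearMap hθ n _ _ fun x ↦ by simp

theorem elemCharpoly_eq_elemNorm (e : E) :
    elemCharpoly R n e = elemNorm R[X] n ((X : R[X]) ⊗ₜ[R] (1 : E) - 1 ⊗ₜ e) := by
  unfold elemCharpoly charpoly elemNorm
  congr 1
  ext x
  simp [TensorProduct.smul_tmul']

variable {A : Type*} [CommRing A] [Algebra R A] [Module.Finite R A] [Module.Projective R A]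
  {Q Q' : Type*} [CommRing Q] [Algebra R Q] [CommRing Q'] [Algebra R Q']

theorem elemNorm_map (φ : Q →ₐ[R] Q') (u : Q ⊗[R] A) :
    elemNorm Q' n (Algebra.TensorProduct.map φ (AlgHom.id R A) u) = φ (elemNorm Q n u) := by
  let _ : Algebra Q Q' := φ.toRingHom.toAlgebra
  have : IsScalarTower R Q Q' := IsScalarTower.of_algebraMap_eq fun r ↦ (φ.commutes r).symm
  let θ : Q ⊗[R] A →ₐ[Q] Q' ⊗[R] A :=
    Algebra.TensorProduct.map (IsScalarTower.toAlgHom Q Q Q' : Q →ₐ[Q] Q') (AlgHom.id R A)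
  refine elemNorm_isBaseChange θ ?_ u
  refine IsBaseChange.of_equiv (AlgebraTensorModule.cancelBaseChange R Q Q' Q' A) fun x ↦ ?_
  induction x with
  | zero => simp
  | add x y hx hy => rw [tmul_add, map_add, hx, hy, map_add]
  | tmul q a => simp [θ, Algebra.smul_def]

/-- The characteristic polynomial of an element of a base change, as a norm. -/
theorem elemCharpoly_eq_elemNorm_map (a : Q ⊗[R] A) :
    elemCharpoly Q n a = elemNorm Q[X] n ((X : Q[X]) ⊗ₜ[R] (1 : A) -
      Algebra.TensorProduct.map ((CAlgHom (R := Q) (A := Q)).restrictScalars R)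
        (AlgHom.id R A) a) := by
  rw [elemCharpoly_eq_elemNorm]
  -- Collapsing the iterated base change to `Q[X] ⊗[R] A` puts the norm in the form `elemNorm_map`
  -- handles.
  let θ := Algebra.TensorProduct.cancelBaseChange R Q Q[X] Q[X] A
  have := elemNorm_isBaseChange (n := n) (θ : Q[X] ⊗[Q] (Q ⊗[R] A) →ₐ[Q[X]] Q[X] ⊗[R] A)
    (IsBaseChange.ofEquiv θ.toLinearEquiv) ((X : Q[X]) ⊗ₜ[Q] (1 : Q ⊗[R] A) - 1 ⊗ₜ a)
  rw [Algebra.algebraMap_self, RingHom.id_apply] at this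
  rw [← this]
  congr 1
  rw [map_sub]
  congr 1
  · simp [θ, Algebra.TensorProduct.one_def]
  · clear this
    induction a with
    | zero => simp
    | add x y hx hy => rw [tmul_add, map_add, map_add, hx, hy]
    | tmul q a => simp [θ, Algebra.smul_def]

end Norm

/-! ### Reversal of polynomials through Laurent polynomials. -/

section Reflect

variable {S : Type*} [CommRing S]

theorem T_one_mul_T_neg_one :
    (LaurentPolynomial.T 1 * LaurentPolynomial.T (-1) : LaurentPolynomial S) = 1 := by
  rw [← LaurentPolynomial.T_add, add_neg_cancel, LaurentPolynomial.T_zero]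

/-- That `T^n P(T⁻¹)` is a polynomial already forces the degree bound on `P`, so none has to be
known beforehand. -/
theorem reflect_of_toLaurent_eq {n : ℕ} {p P : S[X]}
    (h : p.toLaurent = LaurentPolynomial.T n * LaurentPolynomial.invert P.toLaurent) :
    P.natDegree ≤ n ∧ p = P.reflect n := by
  have h1 : p * X ^ P.natDegree = X ^ n * P.reverse := by
    apply Polynomial.toLaurent_injective
    rw [map_mul, map_mul, LaurentPolynomial.toLaurent_reverse, h]
    simp only [map_pow, Polynomial.toLaurent_X, LaurentPolynomial.T_pow, mul_one]
    ring
  have hdeg : P.natDegree ≤ n := by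
    by_contra! hn
    have h2 := congrArg (coeff · n) h1
    simp only [coeff_mul_X_pow', if_neg (not_le.2 hn)] at h2
    rw [coeff_X_pow_mul', if_pos le_rfl, Nat.sub_self, coeff_zero_reverse, eq_comm,
      leadingCoeff_eq_zero] at h2
    simp [h2] at hn
  refine ⟨hdeg, ?_⟩
  ext k
  have h2 := congrArg (coeff · (k + P.natDegree)) h1
  simp only [coeff_mul_X_pow] at h2
  rw [h2, coeff_X_pow_mul', coeff_reflect, coeff_reverse]
  split_ifs with hk
  · rcases le_or_gt k n with hkn | hkn
    · rw [revAt_le hkn, revAt_le (by omega)]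
      congr 1
      omega
    · rw [revAt_eq_self_of_lt hkn, revAt_eq_self_of_lt (by omega),
        coeff_eq_zero_of_natDegree_lt (by omega), coeff_eq_zero_of_natDegree_lt (by omega)]
  · rw [revAt_le (by omega), coeff_eq_zero_of_natDegree_lt (by omega)]

theorem reflect_prod_X_sub_C {n : ℕ} (c : Fin n → S) :
    (∏ i, (X - C (c i))).reflect n = ∏ i, (1 - X * C (c i)) := by
  refine (reflect_of_toLaurent_eq ?_).2.symm
  have : (LaurentPolynomial.T (n : ℤ) : LaurentPolynomial S) =
      ∏ _i : Fin n, LaurentPolynomial.T 1 := by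
    simp [LaurentPolynomial.T_pow]
  rw [map_prod, map_prod, map_prod, this, ← Finset.prod_mul_distrib]
  refine Finset.prod_congr rfl fun i _ ↦ ?_
  simp only [map_sub, map_mul, map_one, toLaurent_X, toLaurent_C, LaurentPolynomial.invert_T,
    LaurentPolynomial.invert_C, mul_sub, T_one_mul_T_neg_one]

end Reflect

/-! ### Generation of the elements `1 + t y` with `t` nilpotent. -/

section Unipotent

variable {R : Type*} [CommRing R] {A : Type*} [CommRing A] [Algebra R A]
  {Q : Type*} [CommRing Q] [Algebra R Q]

/-- To leading order in `t`, multiplying the elements `1 + t^(k+1) • y` adds the `y`, so pure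
tensors suffice up to a higher-order error. -/
theorem exists_mem_eq_one_add (V : Submonoid (Q ⊗[R] A))
    (hV : ∀ (q : Q) (a : A), 1 + q ⊗ₜ a ∈ V) (t : Q) (k : ℕ) (y : Q ⊗[R] A) :
    ∃ v ∈ V, ∃ z, v = 1 + t ^ (k + 1) • y + t ^ (k + 2) • z := by
  induction y with
  | zero => exact ⟨1, V.one_mem, 0, by simp⟩
  | tmul q a => exact ⟨_, hV (t ^ (k + 1) * q) a, 0, by simp [smul_tmul']⟩
  | add y₁ y₂ h₁ h₂ =>
    obtain ⟨v₁, hv₁, z₁, rfl⟩ := h₁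
    obtain ⟨v₂, hv₂, z₂, rfl⟩ := h₂
    refine ⟨_, V.mul_mem hv₁ hv₂, z₁ + z₂ + t ^ k • ((y₁ + t • z₁) * (y₂ + t • z₂)), ?_⟩
    simp only [Algebra.smul_def, map_pow]
    ring

/-- A submonoid containing all `1 + q ⊗ a` contains `1 + t • y` for nilpotent `t`. -/
theorem one_add_smul_mem (V : Submonoid (Q ⊗[R] A))
    (hV : ∀ (q : Q) (a : A), 1 + q ⊗ₜ a ∈ V) {t : Q} {m : ℕ} (ht : t ^ m = 0)
    (y : Q ⊗[R] A) : 1 + t • y ∈ V := by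
  -- Here `d` bounds how many more powers of `t` are needed before `t ^ (k + 1)` vanishes.
  suffices ∀ (d k : ℕ), m ≤ k + 1 + d → ∀ y : Q ⊗[R] A, 1 + t ^ (k + 1) • y ∈ V by
    simpa using this m 0 (by omega) y
  intro d
  induction d with
  | zero =>
    intro k hk y
    rw [pow_eq_zero_of_le (by omega) ht, zero_smul, add_zero]
    exact V.one_mem
  | succ d ih =>
    intro k hk y
    obtain ⟨v, hv, z, h⟩ := exists_mem_eq_one_add V hV t k y
    have hu : IsUnit v := by
      have : IsNilpotent (t ^ (k + 1) • y + t ^ (k + 2) • z) := by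
        refine ⟨m, ?_⟩
        have : t ^ (k + 1) • y + t ^ (k + 2) • z = t • (t ^ k • y + t ^ (k + 1) • z) := by
          simp only [Algebra.smul_def, map_pow]
          ring
        rw [this, _root_.smul_pow, ht, zero_smul]
      rw [h, add_assoc]
      exact this.isUnit_one_add
    obtain ⟨w, hw⟩ := hu.exists_right_inv
    -- The inverse `w` need not lie in `V`; it only enters the higher-order factor, which the
    -- induction covers.
    have h' : 1 + t ^ (k + 1) • y = v * (1 + t ^ (k + 1 + 1) • (-(w * z))) := by
      have : v * (1 + t ^ (k + 1 + 1) • (-(w * z))) = v - (v * w) * (t ^ (k + 2) • z) := by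
        simp only [Algebra.smul_def, map_pow]
        ring
      rw [this, hw, h]
      ring
    rw [h']
    exact V.mul_mem hv (ih (k + 1) (by omega) _)

end Unipotent

/-! ### Splitting of characteristic polynomials passes to base changes. -/

section Splitting

variable {R : Type*} [CommRing R] {A : Type*} [CommRing A] [Algebra R A] [Module.Finite R A]
  [Module.Projective R A] {n : ℕ} {Q : Type*} [CommRing Q] [Algebra R Q]

variable (R A Q) in
/-- The inclusion of constants `Q ⊗ A → Q[X] ⊗ A`. -/
abbrev constMap : Q ⊗[R] A →ₐ[R] Q[X] ⊗[R] A :=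
  Algebra.TensorProduct.map ((CAlgHom (R := Q) (A := Q)).restrictScalars R) (AlgHom.id R A)

omit [Module.Finite R A] [Module.Projective R A] in
theorem smul_eq_tmul_one_mul (q : Q) (u : Q ⊗[R] A) : q • u = (q ⊗ₜ 1) * u := by
  rw [Algebra.smul_def]
  rfl

/-- In Laurent polynomials `1 - T a = T (T⁻¹ - a)`, and the norm is homogeneous of degree `n`. -/
theorem elemCharpoly_reflect (a : Q ⊗[R] A) :
    (elemCharpoly Q n a).natDegree ≤ n ∧
      elemNorm Q[X] n (1 - (X : Q[X]) • constMap R A Q a) = (elemCharpoly Q n a).reflect n := by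
  refine reflect_of_toLaurent_eq ?_
  rw [elemCharpoly_eq_elemNorm_map]
  let ψ : Q[X] →ₐ[R] LaurentPolynomial Q := (toLaurentAlg (R := Q)).restrictScalars R
  let ψ' : Q[X] →ₐ[R] LaurentPolynomial Q :=
    ((LaurentPolynomial.invert (R := Q)).toAlgHom.comp toLaurentAlg).restrictScalars R
  have h1 := elemNorm_map (n := n) ψ (1 - (X : Q[X]) • constMap R A Q a)
  have h2 := elemNorm_map (n := n) ψ' ((X : Q[X]) ⊗ₜ[R] (1 : A) - constMap R A Q a)
  change _ = LaurentPolynomial.invert (toLaurent _) at h2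
  change _ = toLaurent _ at h1
  rw [← h1, ← h2]
  have : (LaurentPolynomial.T (n : ℤ) : LaurentPolynomial Q) = LaurentPolynomial.T 1 ^ n := by
    simp [LaurentPolynomial.T_pow]
  rw [this, ← elemNorm_smul]
  congr 1
  have hC (x : Q ⊗[R] A) : Algebra.TensorProduct.map ψ (AlgHom.id R A) (constMap R A Q x) =
      Algebra.TensorProduct.map ψ' (AlgHom.id R A) (constMap R A Q x) := by
    rw [← AlgHom.comp_apply, ← AlgHom.comp_apply]
    congr 1
    ext x <;> simp [ψ, ψ']
  have hX (x : Q[X] ⊗[R] A) : Algebra.TensorProduct.map ψ (AlgHom.id R A) ((X : Q[X]) • x) =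
      (LaurentPolynomial.T 1 : LaurentPolynomial Q) •
        Algebra.TensorProduct.map ψ (AlgHom.id R A) x := by
    rw [smul_eq_tmul_one_mul, map_mul, smul_eq_tmul_one_mul]
    simp [ψ]
  rw [map_sub, map_sub, hX, hC, smul_sub]
  have hT : Algebra.TensorProduct.map ψ' (AlgHom.id R A) ((X : Q[X]) ⊗ₜ[R] (1 : A)) =
      (LaurentPolynomial.T (-1) : LaurentPolynomial Q) ⊗ₜ 1 := by simp [ψ']
  rw [hT, smul_tmul', smul_eq_mul, T_one_mul_T_neg_one, map_one, Algebra.TensorProduct.one_def]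

theorem rankAtStalk_tensorProduct_eq (hrank : ∀ p : PrimeSpectrum R, Module.rankAtStalk A p = n)
    (p : PrimeSpectrum Q) : Module.rankAtStalk (Q ⊗[R] A) p = n := by
  rw [Module.rankAtStalk_baseChange, hrank]

theorem elemCharpoly_one_tmul (a : A) :
    elemCharpoly Q n ((1 : Q) ⊗ₜ[R] a) = (elemCharpoly R n a).map (algebraMap R Q) := by
  rw [elemCharpoly_eq_elemNorm_map, elemCharpoly_eq_elemNorm]
  refine Eq.trans ?_ (elemNorm_map (mapAlgHom (Algebra.ofId R Q)) _)
  congr 1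
  simp

theorem elemNorm_one_sub_eq_reflect (a : A) :
    elemNorm R[X] n (1 - (X : R[X]) • constMap R A R (1 ⊗ₜ[R] a)) =
      (elemCharpoly R n a).reflect n := by
  rw [(elemCharpoly_reflect ((1 : R) ⊗ₜ[R] a)).2, elemCharpoly_one_tmul, Algebra.algebraMap_self,
    Polynomial.map_id]

theorem elemCharpoly_natDegree_le (a : A) : (elemCharpoly R n a).natDegree ≤ n := by
  have h := (elemCharpoly_reflect (n := n) ((1 : R) ⊗ₜ[R] a)).1
  rwa [elemCharpoly_one_tmul, Algebra.algebraMap_self, Polynomial.map_id] at h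

/-- The coefficient of `X^n` is the constant term of the reversal, namely the norm of `1 - X a` at
`X = 0`. -/
theorem elemCharpoly_monic (hrank : ∀ p : PrimeSpectrum R, Module.rankAtStalk A p = n) (a : A) :
    (elemCharpoly R n a).Monic := by
  refine monic_of_natDegree_le_of_coeff_eq_one n (elemCharpoly_natDegree_le a) ?_
  have h2 := elemNorm_map (n := n) (aeval (R := R) (0 : R))
    (1 - (X : R[X]) • constMap R A R (1 ⊗ₜ[R] a))
  rw [elemNorm_one_sub_eq_reflect, ← coeff_zero_eq_aeval_zero, coeff_reflect,
    revAt_le (Nat.zero_le n), Nat.sub_zero] at h2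
  rw [← h2]
  have h3 : Algebra.TensorProduct.map (aeval (0 : R)) (AlgHom.id R A)
      (1 - (X : R[X]) • constMap R A R (1 ⊗ₜ[R] a)) = (1 : R ⊗[R] A) := by
    rw [smul_eq_tmul_one_mul, map_sub, map_mul, map_one, Algebra.TensorProduct.map_tmul, aeval_X,
      zero_tmul, zero_mul, sub_zero]
  rw [h3]
  exact elemNorm_one (rankAtStalk_tensorProduct_eq hrank)

variable {G : Type*} [CommRing G] [Algebra R G] {f : Fin n → A →ₐ[R] G}
  {B : Type*} [CommRing B] [Algebra R B]

/-- `1 + q ⊗ a` is `1 - X a` specialized at `X = -q`, and the norm of `1 - X a` is the reversed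
`P_a`, which `H` factors. -/
theorem map_elemNorm_one_add_tmul
    (H : ∀ a, (elemCharpoly R n a).map (algebraMap R G) = ∏ i, (X - C (f i a)))
    (φ : Q →ₐ[R] B) (g : G →ₐ[R] B) (q : Q) (a : A) :
    φ (elemNorm Q n (1 + q ⊗ₜ[R] a)) =
      ∏ i, Algebra.TensorProduct.productMap φ (g.comp (f i)) (1 + q ⊗ₜ[R] a) := by
  have h1 : (1 + q ⊗ₜ[R] a : Q ⊗[R] A) = Algebra.TensorProduct.map (aeval (-q)) (AlgHom.id R A)
      (1 - (X : R[X]) • constMap R A R (1 ⊗ₜ[R] a)) := by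
    simp [smul_tmul', neg_tmul]
  conv_lhs => rw [h1, elemNorm_map, elemNorm_one_sub_eq_reflect, ← aeval_algHom_apply]
  have h2 : algebraMap R B = (g : G →+* B).comp (algebraMap R G) := g.comp_algebraMap.symm
  rw [aeval_def, h2, ← eval₂_map, ← reflect_map, H, reflect_prod_X_sub_C, eval₂_finsetProd]
  refine Finset.prod_congr rfl fun i _ ↦ ?_
  simp [eval₂_sub, eval₂_mul]
  exact mul_comm _ _

theorem map_elemNorm_one_add_smul (hrank : ∀ p : PrimeSpectrum R, Module.rankAtStalk A p = n)
    (H : ∀ a, (elemCharpoly R n a).map (algebraMap R G) = ∏ i, (X - C (f i a)))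
    (φ : Q →ₐ[R] B) (g : G →ₐ[R] B) {t : Q} {m : ℕ} (ht : t ^ m = 0) (y : Q ⊗[R] A) :
    φ (elemNorm Q n (1 + t • y)) =
      ∏ i, Algebra.TensorProduct.productMap φ (g.comp (f i)) (1 + t • y) := by
  have hQ := rankAtStalk_tensorProduct_eq (Q := Q) hrank
  -- The locus where the two multiplicative functions agree.
  let V : Submonoid (Q ⊗[R] A) :=
    { carrier := {u | φ (elemNorm Q n u) =
        ∏ i, Algebra.TensorProduct.productMap φ (g.comp (f i)) u}
      one_mem' := by simp [elemNorm_one hQ]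
      mul_mem' := by
        intro u v hu hv
        simp only [Set.mem_ofPred_eq] at hu hv ⊢
        rw [elemNorm_mul hQ, map_mul, hu, hv, ← Finset.prod_mul_distrib]
        simp only [map_mul] }
  exact one_add_smul_mem V (fun q a ↦ map_elemNorm_one_add_tmul H φ g q a) ht y

omit [Module.Finite R A] [Module.Projective R A] in
theorem productMap_map_linear {Q' : Type*} [CommRing Q'] [Algebra R Q'] (h : A →ₐ[R] G)
    (π : Q[X] →ₐ[R] Q') (ρ : (Q ⊗[R] G)[X] →ₐ[R] B) (φ : Q' →ₐ[R] B)
    (hφ : ∀ p, φ (π p) = ρ (p.map (algebraMap Q (Q ⊗[R] G)))) (a : Q ⊗[R] A) :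
    Algebra.TensorProduct.productMap φ
      ((ρ.comp ((CAlgHom (R := Q ⊗[R] G) (A := Q ⊗[R] G)).restrictScalars R)).comp
        (Algebra.TensorProduct.includeRight.comp h))
      (Algebra.TensorProduct.map π (AlgHom.id R A) (1 - (X : Q[X]) • constMap R A Q a)) =
    ρ (1 - X * C (Algebra.TensorProduct.map (AlgHom.id Q Q) h a)) := by
  rw [smul_eq_tmul_one_mul]
  simp only [map_sub, map_mul, map_one]
  congr 2
  · simp [hφ, ← Algebra.TensorProduct.one_def]
  · induction a with
    | zero => simp
    | add x y hx hy => simp only [map_add, hx, hy]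
    | tmul q a =>
      simp only [Algebra.TensorProduct.map_tmul, Algebra.TensorProduct.productMap_apply_tmul,
        AlgHom.id_apply, AlgHom.comp_apply, AlgHom.restrictScalars_apply, CAlgHom_apply, hφ,
        Polynomial.map_C, Algebra.TensorProduct.includeRight_apply]
      rw [← map_mul, ← map_mul, Algebra.TensorProduct.algebraMap_apply,
        Algebra.TensorProduct.tmul_mul_tmul]
      simp

theorem truncated_reflect_eq (hrank : ∀ p : PrimeSpectrum R, Module.rankAtStalk A p = n)
    (H : ∀ a, (elemCharpoly R n a).map (algebraMap R G) = ∏ i, (X - C (f i a)))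
    {Q' : Type*} [CommRing Q'] [Algebra R Q']
    (π : Q[X] →ₐ[R] Q') (ρ : (Q ⊗[R] G)[X] →ₐ[R] B) (φ : Q' →ₐ[R] B)
    (hφ : ∀ p, φ (π p) = ρ (p.map (algebraMap Q (Q ⊗[R] G)))) {m : ℕ} (hX : π X ^ m = 0)
    (a : Q ⊗[R] A) :
    ρ (((elemCharpoly Q n a).map (algebraMap Q (Q ⊗[R] G))).reflect n) =
      ρ ((∏ i, (X - C (Algebra.TensorProduct.map (AlgHom.id Q Q) (f i) a))).reflect n) := by
  let μ := Algebra.TensorProduct.map π (AlgHom.id R A)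
  have hμ : μ (1 - (X : Q[X]) • constMap R A Q a) = 1 + π X • (- μ (constMap R A Q a)) := by
    rw [smul_eq_tmul_one_mul, map_sub, map_mul, map_one, smul_neg, sub_eq_add_neg,
      smul_eq_tmul_one_mul]
    simp [μ]
  have key := map_elemNorm_one_add_smul hrank H φ
    (ρ.comp (((CAlgHom (R := Q ⊗[R] G) (A := Q ⊗[R] G)).restrictScalars R).comp
      Algebra.TensorProduct.includeRight)) hX (- μ (constMap R A Q a))
  rw [← hμ, elemNorm_map, (elemCharpoly_reflect a).2, hφ, ← reflect_map] at key
  rw [key, reflect_prod_X_sub_C, map_prod]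
  exact Finset.prod_congr rfl fun i _ ↦ productMap_map_linear (f i) π ρ φ hφ a

/-- If the characteristic polynomials of all elements of `A` split along `f`, so do those of all
elements of every base change of `A`. -/
theorem map_elemCharpoly_eq_prod (hrank : ∀ p : PrimeSpectrum R, Module.rankAtStalk A p = n)
    (H : ∀ a, (elemCharpoly R n a).map (algebraMap R G) = ∏ i, (X - C (f i a)))
    (a : Q ⊗[R] A) :
    (elemCharpoly Q n a).map (algebraMap Q (Q ⊗[R] G)) =
      ∏ i, (X - C (Algebra.TensorProduct.map (AlgHom.id Q Q) (f i) a)) := by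
  have hdeg := (elemCharpoly_reflect (R := R) (n := n) a).1
  -- The exponent `n + 1` makes `X` nilpotent while keeping every coefficient of a polynomial of
  -- degree at most `n`.
  let I : Ideal Q[X] := Ideal.span {X ^ (n + 1)}
  let J : Ideal (Q ⊗[R] G)[X] := Ideal.span {X ^ (n + 1)}
  let ψ : Q[X] →ₐ[R] (Q ⊗[R] G)[X] := mapAlgHom Algebra.TensorProduct.includeLeft
  have hIJ : ∀ x ∈ I, (Ideal.Quotient.mkₐ R J).comp ψ x = 0 := by
    intro x hx
    obtain ⟨y, rfl⟩ := Ideal.mem_span_singleton.1 hx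
    rw [AlgHom.comp_apply, Ideal.Quotient.mkₐ_eq_mk, Ideal.Quotient.eq_zero_iff_mem]
    exact Ideal.mem_span_singleton.2 ⟨ψ y, by simp [ψ]⟩
  have ht : (Ideal.Quotient.mkₐ R I X) ^ (n + 1) = 0 := by
    rw [← map_pow, Ideal.Quotient.mkₐ_eq_mk, Ideal.Quotient.eq_zero_iff_mem]
    exact Ideal.mem_span_singleton_self _
  let φ : Q[X] ⧸ I →ₐ[R] (Q ⊗[R] G)[X] ⧸ J :=
    Ideal.Quotient.liftₐ I ((Ideal.Quotient.mkₐ R J).comp ψ) hIJ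
  have hφ (p : Q[X]) : φ (Ideal.Quotient.mkₐ R I p) =
      Ideal.Quotient.mkₐ R J (p.map (algebraMap Q (Q ⊗[R] G))) := rfl
  have key := truncated_reflect_eq (B := (Q ⊗[R] G)[X] ⧸ J) (Q' := Q[X] ⧸ I) hrank H
    (Ideal.Quotient.mkₐ R I) (Ideal.Quotient.mkₐ R J) φ hφ ht a
  rw [Ideal.Quotient.mkₐ_eq_mk, Ideal.Quotient.eq, Ideal.mem_span_singleton, X_pow_dvd_iff] at key
  have hprodDeg : (∏ i, (X - C (Algebra.TensorProduct.map (AlgHom.id Q Q) (f i) a))).natDegree ≤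
      n := by
    refine (natDegree_prod_le _ _).trans ?_
    refine (Finset.sum_le_sum fun i _ ↦ natDegree_X_sub_C_le _).trans ?_
    simp
  ext j
  rcases le_or_gt j n with hj | hj
  · have := key (n - j) (by omega)
    rw [coeff_sub, coeff_reflect, coeff_reflect, revAt_le (by omega),
      Nat.sub_sub_self hj, sub_eq_zero] at this
    exact this
  · rw [coeff_eq_zero_of_natDegree_lt ((natDegree_map_le.trans hdeg).trans_lt hj),
      coeff_eq_zero_of_natDegree_lt (hprodDeg.trans_lt hj)]

end Splitting

/-! ### The universal property of the Galois closure. -/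

section GaloisClosure

variable (R : Type u) [CommRing R] (A : Type v) [CommRing A] [Algebra R A]
  [Module.Finite R A] [Module.Projective R A] (n : ℕ)

theorem map_elemCharpoly_galoisMap (a : A) :
    (elemCharpoly R n a).map (algebraMap R (GaloisClosure R A n)) =
      ∏ i, (X - C (galoisMap R A n i a)) := by
  let π := Ideal.Quotient.mk (galoisIdeal R A n)
  let P : (⨂[R] _ : Fin n, A)[X] := (elemCharpoly R n a).map (algebraMap R (⨂[R] _ : Fin n, A))
  let D : (⨂[R] _ : Fin n, A)[X] := ∏ i : Fin n,
    (X - C (PiTensorProduct.singleAlgHom (R := R) (A := fun _ : Fin n ↦ A) i a))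
  have h : P.map π = D.map π := by
    ext j
    rw [← sub_eq_zero, ← coeff_sub, ← Polynomial.map_sub, coeff_map]
    exact Ideal.Quotient.eq_zero_iff_mem.2 (Ideal.subset_span ⟨a, j, rfl⟩)
  have h1 : P.map π = (elemCharpoly R n a).map (algebraMap R (GaloisClosure R A n)) := by
    rw [Polynomial.map_map]
    rfl
  have h2 : D.map π = ∏ i, (X - C (galoisMap R A n i a)) := by
    simp only [D, Polynomial.map_prod, Polynomial.map_sub, Polynomial.map_X, Polynomial.map_C]
    rfl
  rw [← h1, h, h2]

variable {R A n}

theorem DividesCharpoly.map_elemCharpoly_eq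
    (hrank : ∀ p : PrimeSpectrum R, Module.rankAtStalk A p = n) {B : Type*} [CommRing B]
    [Algebra R B] {β : Fin n → A →ₐ[R] B} (hβ : DividesCharpoly R A n β) (a : A) :
    (elemCharpoly R n a).map (algebraMap R B) = ∏ i, (X - C (β i a)) := by
  nontriviality B
  -- `DividesCharpoly` ranges over rings in `Type (max u v)`, so the case `R' = R` is reached
  -- through a lift of `R`.
  let S := ULift.{max u v} R
  let e : S ⊗[R] B →ₐ[R] B :=
    Algebra.TensorProduct.productMap
      ((Algebra.ofId R B).comp (ULift.algEquiv (R := R) (A := R) : S →ₐ[R] R)) (AlgHom.id R B)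
  have h := Polynomial.map_dvd (e : S ⊗[R] B →+* B) (hβ S ((1 : S) ⊗ₜ[R] a))
  have he : ((e : S ⊗[R] B →+* B).comp (algebraMap S (S ⊗[R] B))).comp (algebraMap R S) =
      algebraMap R B := by
    rw [RingHom.comp_assoc, ← IsScalarTower.algebraMap_eq, e.comp_algebraMap]
  rw [elemCharpoly_one_tmul, Polynomial.map_map, Polynomial.map_map, he] at h
  have h1 : (∏ i, (X - C (Algebra.TensorProduct.map (AlgHom.id S S) (β i) (1 ⊗ₜ[R] a)))).map
      (e : S ⊗[R] B →+* B) = ∏ i, (X - C (β i a)) := by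
    simp [Polynomial.map_prod, e]
  rw [h1] at h
  refine (eq_of_monic_of_dvd_of_natDegree_le (monic_prod_of_monic _ _ fun i _ ↦ monic_X_sub_C _)
    ((elemCharpoly_monic hrank a).map _) h ?_)
  rw [natDegree_prod_of_monic _ _ fun i _ ↦ monic_X_sub_C _]
  simpa using natDegree_map_le.trans (elemCharpoly_natDegree_le a)

theorem algHom_ext_galoisMap {B : Type*} [CommRing B] [Algebra R B]
    {φ ψ : GaloisClosure R A n →ₐ[R] B}
    (h : ∀ i, φ.comp (galoisMap R A n i) = ψ.comp (galoisMap R A n i)) : φ = ψ := by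
  refine Ideal.Quotient.algHom_ext _ (PiTensorProduct.algHom_ext fun i ↦ ?_)
  exact h i

/-- The map from the Galois closure induced by maps along which characteristic polynomials
split. -/
theorem exists_lift_galoisClosure {B : Type*} [CommRing B] [Algebra R B] (β : Fin n → A →ₐ[R] B)
    (H : ∀ a, (elemCharpoly R n a).map (algebraMap R B) = ∏ i, (X - C (β i a))) :
    ∃ φ : GaloisClosure R A n →ₐ[R] B, ∀ i, φ.comp (galoisMap R A n i) = β i := by
  let m : MultilinearMap R (fun _ : Fin n ↦ A) B :=
    (MultilinearMap.mkPiAlgebra R (Fin n) B).compLinearMap fun i ↦ (β i).toLinearMap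
  have hm (x : Fin n → A) : m x = ∏ i, β i (x i) := rfl
  let F : (⨂[R] _ : Fin n, A) →ₐ[R] B := PiTensorProduct.liftAlgHom m
    (by simp [hm]) (fun x y ↦ by simp [hm, Finset.prod_mul_distrib])
  have hF (i : Fin n) (a : A) :
      F (PiTensorProduct.singleAlgHom (R := R) (A := fun _ : Fin n ↦ A) i a) = β i a := by
    refine (PiTensorProduct.lift.tprod (φ := m) (Pi.mulSingle i a)).trans ?_
    rw [hm, Finset.prod_eq_single i (fun j _ hj ↦ by simp [hj]) (by simp), Pi.mulSingle_eq_same]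
  have hI : ∀ x ∈ galoisIdeal R A n, F x = 0 := by
    intro x hx
    suffices galoisIdeal R A n ≤ RingHom.ker F from this hx
    refine Ideal.span_le.2 ?_
    rintro _ ⟨a, j, rfl⟩
    change (F : (⨂[R] _ : Fin n, A) →+* B) _ = 0
    rw [← coeff_map, Polynomial.map_sub, Polynomial.map_map, F.comp_algebraMap, H,
      Polynomial.map_prod, sub_eq_zero.2, coeff_zero]
    simp only [Polynomial.map_sub, Polynomial.map_X, Polynomial.map_C, RingHom.coe_coe, hF]
  exact ⟨Ideal.Quotient.liftₐ _ F hI, fun i ↦ AlgHom.ext fun a ↦ hF i a⟩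

theorem isSClosure_galoisMap (hrank : ∀ p : PrimeSpectrum R, Module.rankAtStalk A p = n) :
    IsSClosure R A n (galoisMap R A n) where
  dividesCharpoly R' _ _ a :=
    (map_elemCharpoly_eq_prod hrank (map_elemCharpoly_galoisMap R A n) a).symm.dvd
  existsUnique_lift B _ _ β hβ := by
    obtain ⟨φ, hφ⟩ := exists_lift_galoisClosure β (hβ.map_elemCharpoly_eq hrank)
    exact ⟨φ, hφ, fun ψ hψ ↦ algHom_ext_galoisMap fun i ↦ (hψ i).trans (hφ i).symm⟩

theorem IsSClosure.existsUnique_algEquiv {S : Type*} [Fintype S] {C D : Type (max u v)}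
    [CommRing C] [Algebra R C] [CommRing D] [Algebra R D] {α : S → A →ₐ[R] C}
    {β : S → A →ₐ[R] D} (hα : IsSClosure R A n α) (hβ : IsSClosure R A n β) :
    ∃! e : C ≃ₐ[R] D, ∀ s, (e : C →ₐ[R] D).comp (α s) = β s := by
  obtain ⟨φ, hφ, hφu⟩ := hα.existsUnique_lift D β hβ.dividesCharpoly
  obtain ⟨ψ, hψ, -⟩ := hβ.existsUnique_lift C α hα.dividesCharpoly
  have h1 : φ.comp ψ = AlgHom.id R D :=
    (hβ.existsUnique_lift D β hβ.dividesCharpoly).unique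
      (fun s ↦ by rw [AlgHom.comp_assoc, hψ, hφ]) fun s ↦ AlgHom.id_comp _
  have h2 : ψ.comp φ = AlgHom.id R C :=
    (hα.existsUnique_lift C α hα.dividesCharpoly).unique
      (fun s ↦ by rw [AlgHom.comp_assoc, hφ, hψ]) fun s ↦ AlgHom.id_comp _
  refine ⟨AlgEquiv.ofAlgHom φ ψ h1 h2, hφ, fun e he ↦ ?_⟩
  ext x
  exact DFunLike.congr_fun (hφu e he) x

end GaloisClosure

end

end SClosure

theorem mainTheorem9 (R : Type u) [CommRing R] (A : Type v) [CommRing A] [Algebra R A]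
    [Module.Finite R A] [Module.Projective R A] (n : ℕ)
    (hrank : ∀ p : PrimeSpectrum R, Module.rankAtStalk A p = n) :
    SClosure.IsSClosure R A n (SClosure.galoisMap R A n) ∧
    ∀ (C : Type (max u v)) [CommRing C] [Algebra R C] (α : Fin n → A →ₐ[R] C),
      SClosure.IsSClosure R A n α →
        ∃! e : C ≃ₐ[R] SClosure.GaloisClosure R A n,
          ∀ i, (e : C →ₐ[R] SClosure.GaloisClosure R A n).comp (α i) =
            SClosure.galoisMap R A n i :=
  ⟨SClosure.isSClosure_galoisMap hrank, fun _ _ _ _ hα ↦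
    hα.existsUnique_algEquiv (SClosure.isSClosure_galoisMap hrank)⟩
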